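/- Let $H_3(\mathbb R)$ be the group of real $3\times 3$ upper triangular matrices with ones on the diagonal, let $\mathfrak h_3(\mathbb R)$ be its Lie algebra of strictly upper triangular matrices, with matrix exponential $\exp$, let $P(\mathfrak h_3(\mathbb R))$ be the set of lines (1-dimensional subspaces) of $\mathfrak h_3(\mathbb R)$, and let $\Gamma=H_3(\mathbb Z)$ be the lattice of matrices with integer entries in $H_3(\mathbb R)$. For a measure preserving action $T=(T_\gamma)_{\gamma\in\Gamma}$ on a $\sigma$-finite standard measure space $(X,\mu)$ and a right-invariant metric $\mathrm{dist}$ on $H_3(\mathbb R)$ compatible with the topology, $T$ is recurrent along a line $\theta\in P(\mathfrak h_3(\mathbb R))$ if for every $\epsilon>0$ and every measurable $A\subset X$ with $\mu(A)>0$ there are $\gamma\in\Gamma\setminus\{1\}$ and $g\in\exp(\theta)$ with $\mathrm{dist}(\gamma,g)<\epsilon$ and $\mu(A\cap T_\gamma A)>0$; $\mathcal R(T)$ denotes the set of all such $\theta$. The action $T$ is of rank one if there are a Følner sequence $(F_n)$ of nonempty finite subsets of $\Gamma$ (that is, $\#(\gamma F_n\triangle F_n)/\#F_n\to0$ for every $\gamma\in\Gamma$)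 and measurable sets $B_n\subset X$ of finite measure such that for each $n$ the sets $T_fB_n$, $f\in F_n$, are pairwise disjoint, and for every measurable $A$ of finite measure there are $S_n\subset F_n$ with $\mu\bigl(A\triangle\bigcup_{f\in S_n}T_fB_n\bigr)\to 0$. **Theorem 6.1.** There is a free rank-one measure preserving action $T$ of $H_3(\mathbb Z)$ on a nonatomic $\sigma$-finite standard measure space $(X,\mu)$ with $\mu(X)=\infty$ such that $\mathcal R(T)=\emptyset$ (for every right-invariant metric on $H_3(\mathbb R)$ compatible with the topology). -/

import Mathlib

open scoped Pointwise

noncomputable section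

/-- The real Heisenberg group `H₃(ℝ)`: upper triangular `3 × 3` real matrices with ones on the
diagonal, as a subgroup of `SL₃(ℝ)`, with the subspace topology. -/
def heisenbergGroup : Subgroup (Matrix.SpecialLinearGroup (Fin 3) ℝ) where
  carrier := {g | (∀ i, g i i = 1) ∧ ∀ i j, j < i → g i j = 0}
  one_mem' := by
    refine ⟨fun i => by simp, fun i j hij => ?_⟩
    simp [Matrix.one_apply_ne (ne_of_gt hij)]
  mul_mem' := by
    rintro g h ⟨hg, hg'⟩ ⟨hh, hh'⟩
    have e1 := hg' 1 0 (by decide)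
    have e2 := hg' 2 0 (by decide)
    have e3 := hg' 2 1 (by decide)
    have f1 := hh' 1 0 (by decide)
    have f2 := hh' 2 0 (by decide)
    have f3 := hh' 2 1 (by decide)
    refine ⟨fun i => ?_, fun i j hij => ?_⟩
    · fin_cases i <;>
        simp [Matrix.SpecialLinearGroup.coe_mul, Matrix.mul_apply, Fin.sum_univ_three, hg, hh,
          e1, e2, e3, f1, f2, f3]
    · fin_cases i <;> fin_cases j <;> first
        | exact absurd hij (by decide)
        | simp [Matrix.SpecialLinearGroup.coe_mul, Matrix.mul_apply, Fin.sum_univ_three, hg, hh,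
            e1, e2, e3, f1, f2, f3]
  inv_mem' := by
    rintro g ⟨hg, hg'⟩
    have e1 := hg' 1 0 (by decide)
    have e2 := hg' 2 0 (by decide)
    have e3 := hg' 2 1 (by decide)
    refine ⟨fun i => ?_, fun i j hij => ?_⟩
    · fin_cases i <;>
        simp [Matrix.SpecialLinearGroup.coe_inv, Matrix.adjugate_fin_three, hg, e1, e2, e3]
    · fin_cases i <;> fin_cases j <;> first
        | exact absurd hij (by decide)
        | simp [Matrix.SpecialLinearGroup.coe_inv, Matrix.adjugate_fin_three, hg, e1, e2, e3]

/-- The underlying `3 × 3` matrix of an element of `H₃(ℝ)`. -/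
def heisenbergMatrix (g : heisenbergGroup) : Matrix (Fin 3) (Fin 3) ℝ :=
  ((g : Matrix.SpecialLinearGroup (Fin 3) ℝ) : Matrix (Fin 3) (Fin 3) ℝ)

/-- The lattice `H₃(ℤ)` in `H₃(ℝ)`: the elements all of whose entries are integers. -/
def heisenbergLattice : Subgroup heisenbergGroup where
  carrier := {g | ∀ i j, ∃ n : ℤ, heisenbergMatrix g i j = n}
  one_mem' := fun i j => ⟨(1 : Matrix (Fin 3) (Fin 3) ℤ) i j, by
    simp [heisenbergMatrix, Matrix.one_apply]⟩
  mul_mem' := by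
    intro g h hg hh i j
    choose a ha using hg
    choose b hb using hh
    exact ⟨∑ k, a i k * b k j, by
      simp only [heisenbergMatrix] at ha hb ⊢
      simp [Matrix.SpecialLinearGroup.coe_mul, Matrix.mul_apply, ha, hb]⟩
  inv_mem' := by
    intro g hg i j
    choose a ha using hg
    refine ⟨(Matrix.of a).adjugate i j, ?_⟩
    have h : heisenbergMatrix g = (Matrix.of a).map (Int.castRingHom ℝ) := by
      ext i j
      simp [ha]
    have h2 : heisenbergMatrix g⁻¹ = (heisenbergMatrix g).adjugate := by
      simp [heisenbergMatrix, Matrix.SpecialLinearGroup.coe_inv]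
    rw [h2, h, ← RingHom.mapMatrix_apply, ← RingHom.map_adjugate]
    rfl

/-- The (vector space underlying the) Lie algebra `𝔥₃(ℝ)` of `H₃(ℝ)`: strictly upper triangular
`3 × 3` real matrices. -/
def heisenbergLie : Submodule ℝ (Matrix (Fin 3) (Fin 3) ℝ) where
  carrier := {v | ∀ i j, j ≤ i → v i j = 0}
  zero_mem' := fun _ _ _ => rfl
  add_mem' := by
    intro v w hv hw i j hij
    simp [hv i j hij, hw i j hij]
  smul_mem' := by
    intro c v hv i j hij
    simp [hv i j hij]

/-- The one-parameter subgroup `exp(θ)` of `H₃(ℝ)` attached to a line `θ` in `𝔥₃(ℝ)`, where `exp`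
is the matrix exponential. -/
def expLine (θ : Projectivization ℝ heisenbergLie) : Set heisenbergGroup :=
  {g | ∃ v ∈ θ.submodule,
    heisenbergMatrix g = NormedSpace.exp (v : Matrix (Fin 3) (Fin 3) ℝ)}

/-- The metric `m` on the topological group `G` is right-invariant and induces the topology
of `G`. -/
def IsRightInvariantCompatible {G : Type*} [Group G] [t : TopologicalSpace G]
    (m : MetricSpace G) : Prop :=
  m.toPseudoMetricSpace.toUniformSpace.toTopologicalSpace = t ∧
    ∀ a b c : G, m.dist (a * c) (b * c) = m.dist a b

/-- The set `𝓡(T)` of recurrent directions of an action of `H₃(ℤ)` on `(X, μ)`, computed with the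
metric `m` on `H₃(ℝ)`. -/
def recurrentDirections (m : MetricSpace heisenbergGroup) {X : Type*} [MeasurableSpace X]
    [MulAction heisenbergLattice X] (μ : MeasureTheory.Measure X) :
    Set (Projectivization ℝ heisenbergLie) :=
  {θ | ∀ ε : ℝ, 0 < ε → ∀ A : Set X, MeasurableSet A → 0 < μ A →
    ∃ γ : heisenbergLattice, γ ≠ 1 ∧ (∃ g ∈ expLine θ, m.dist (γ : heisenbergGroup) g < ε) ∧
      0 < μ (A ∩ γ • A)}

/-- A (left) Følner sequence of nonempty finite subsets of a discrete group. -/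
def IsFolnerSeq {Γ : Type*} [Group Γ] (F : ℕ → Finset Γ) : Prop :=
  (∀ n, (F n).Nonempty) ∧
    ∀ γ : Γ, Filter.Tendsto
      (fun n => (Set.ncard (symmDiff (γ • (F n : Set Γ)) (F n : Set Γ)) : ℝ) / ((F n).card : ℝ))
      Filter.atTop (nhds 0)

/-- Rank one: there are Rokhlin towers with bases `B n`, whose shapes `F n` form a Følner sequence,
such that every measurable set of finite measure is asymptotically approximated by unions of
levels of the towers. -/
def IsRankOne (Γ : Type*) [Group Γ] {X : Type*} [MeasurableSpace X] [MulAction Γ X]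
    (μ : MeasureTheory.Measure X) : Prop :=
  ∃ F : ℕ → Finset Γ, IsFolnerSeq F ∧ ∃ B : ℕ → Set X,
    (∀ n, MeasurableSet (B n) ∧ μ (B n) < ⊤) ∧
    (∀ n, ∀ f ∈ F n, ∀ f' ∈ F n, f ≠ f' → Disjoint (f • B n) (f' • B n)) ∧
    ∀ A : Set X, MeasurableSet A → μ A < ⊤ →
      ∃ S : ℕ → Finset Γ, (∀ n, S n ⊆ F n) ∧
        Filter.Tendsto (fun n => μ (symmDiff A (⋃ f ∈ S n, f • B n))) Filter.atTop (nhds 0)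

end

/-! The action comes from cutting and stacking with two copies at each stage. Put `c i = (8 ^ i, 2 ^
i, 0)` and identify pairs in `Γ × {0,1}^ℕ` whose sequences agree from some `n` on and whose products
`g * word c y n` agree. Left multiplication by `Γ` respects this relation. Since words determine
their digits (`UniqueWords`), a class meets each slice `{g} × {0,1}^ℕ` at most once, and counting
measure times coin measure restricts to an invariant measure on a Borel transversal.

Everything else rests on `word_eq_dichotomy`. The base of tower `n` consists of the classes of `(1,
y)` with `y` starting with `n` zeros. If it meets its translate by `γ ≠ 1`, then modulo the centre
`γ` is `(∑ d i * 8 ^ i, ∑ d i * 2 ^ i)` with `d i ∈ {-1, 0, 1}` and `d i = 0` for `i < n`. If `k ≥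
n` is the top nonzero index, the second entry `b` is nonzero with `|b| < 2 ^ (k + 1)`, while the
first entry `a` has size of order `8 ^ k`; hence `|a| ≥ n * |b|`. A line whose `(1,2)` entry is
nonzero has a fixed slope and cannot follow such `γ` for large `n`; a line whose `(1,2)` entry
vanishes cannot come close because `b` is a nonzero integer. So the base is a wandering set for
every direction.

The same growth makes the translates of the base by a box of side about `∑_{i < n} 8 ^ i` disjoint,
and these boxes are Følner, which gives rank one. Central translates of the whole base `base c 0`
are disjoint, so the measure is infinite. -/

open MeasureTheory Set

noncomputable section

namespace CutStack

/-! ### Coin tossing and finite flips -/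

/-- The fair coin tossing measure on `{0,1}^ℕ`. -/
def coinMeasure : Measure (ℕ → Bool) :=
  Measure.infinitePi fun _ => (PMF.uniformOfFintype Bool).toMeasure

instance : IsProbabilityMeasure coinMeasure := by
  unfold coinMeasure; infer_instance

/-- Flip the coordinates that belong to the finite set `s`. -/
def flip (s : Finset ℕ) (y : ℕ → Bool) : ℕ → Bool := fun i => xor (y i) (decide (i ∈ s))

theorem flip_flip (s : Finset ℕ) (y : ℕ → Bool) : flip s (flip s y) = y := by
  funext i; simp [flip]

theorem flip_left_injective (y : ℕ → Bool) : Function.Injective fun s => flip s y := by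
  intro s t h
  ext i
  have := congrFun h i
  simpa [flip] using this

theorem measurable_flip (s : Finset ℕ) : Measurable (flip s) := by
  refine measurable_pi_lambda _ fun i => ?_
  exact (Measurable.of_discrete (f := fun b : Bool => xor b (decide (i ∈ s)))).comp
    (measurable_pi_apply i)

theorem map_xor_uniform (b : Bool) :
    ((PMF.uniformOfFintype Bool).toMeasure).map (fun a => xor a b)
      = (PMF.uniformOfFintype Bool).toMeasure := by
  refine Measure.ext_of_singleton fun a => ?_
  rw [Measure.map_apply Measurable.of_discrete (measurableSet_singleton a)]
  have : (fun x => xor x b) ⁻¹' {a} = {xor a b} := by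
    ext x; cases x <;> cases a <;> cases b <;> simp
  rw [this, PMF.toMeasure_apply_singleton _ _ (measurableSet_singleton _),
    PMF.toMeasure_apply_singleton _ _ (measurableSet_singleton _)]
  simp

theorem measurePreserving_flip (s : Finset ℕ) :
    MeasurePreserving (flip s) coinMeasure coinMeasure := by
  refine ⟨measurable_flip s, ?_⟩
  unfold coinMeasure
  have := Measure.infinitePi_map_pi (fun _ : ℕ => (PMF.uniformOfFintype Bool).toMeasure)
    (f := fun i a => xor a (decide (i ∈ s))) (fun _ => Measurable.of_discrete)
  simp only [map_xor_uniform] at this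
  exact this

theorem coinMeasure_cylinder (y : ℕ → Bool) (n : ℕ) :
    coinMeasure {z | ∀ i < n, z i = y i} = 2⁻¹ ^ n := by
  have : {z : ℕ → Bool | ∀ i < n, z i = y i}
      = Set.pi (Finset.range n : Set ℕ) fun i => {y i} := by
    ext y; simp [Set.mem_pi]
  rw [this, coinMeasure, Measure.infinitePi_pi _ (fun _ _ => measurableSet_singleton _)]
  simp only [PMF.toMeasure_apply_singleton _ _ (measurableSet_singleton _)]
  simp

theorem coinMeasure_singleton (y : ℕ → Bool) : coinMeasure {y} = 0 := by
  have h : Filter.Tendsto (fun n : ℕ => (2⁻¹ : ENNReal) ^ n) Filter.atTop (nhds 0) :=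
    ENNReal.tendsto_pow_atTop_nhds_zero_of_lt_one (by norm_num)
  refine le_antisymm (ge_of_tendsto' h fun n => ?_) bot_le
  rw [← coinMeasure_cylinder y n]
  exact measure_mono (by rintro z rfl i _; rfl)

/-! ### The tail relation, its transversal and the action -/

section Space

variable {Γ : Type} [Group Γ]

/-- The product `∏_{i < n} c i ^ y i`. -/
def word (c : ℕ → Γ) (y : ℕ → Bool) : ℕ → Γ
  | 0 => 1
  | n + 1 => word c y n * (if y n then c n else 1)

theorem word_congr (c : ℕ → Γ) {y z : ℕ → Bool} {n : ℕ} (h : ∀ i < n, y i = z i) :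
    word c y n = word c z n := by
  induction n with
  | zero => rfl
  | succ n ih => rw [word, word, ih fun i hi => h i (by omega), h n (by omega)]

theorem mul_word_eq_of_le {c : ℕ → Γ} {y z : ℕ → Bool} {g h : Γ} {n m : ℕ} (hnm : n ≤ m)
    (ht : ∀ i, n ≤ i → y i = z i) (hn : g * word c y n = h * word c z n) :
    g * word c y m = h * word c z m := by
  induction m, hnm using Nat.le_induction with
  | base => exact hn
  | succ m hm ih => rw [word, word, ← mul_assoc, ← mul_assoc, ih, ht m hm]

/-- The equivalence relation on `Γ × {0,1}^ℕ` generated by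
`(g, y) ∼ (g * word c y n, 0 ⋯ 0 y n y (n+1) ⋯)`. -/
def Rel (c : ℕ → Γ) (p q : Γ × (ℕ → Bool)) : Prop :=
  ∃ n, (∀ i, n ≤ i → p.2 i = q.2 i) ∧ p.1 * word c p.2 n = q.1 * word c q.2 n

variable {c : ℕ → Γ} {p q r : Γ × (ℕ → Bool)}

theorem Rel.refl (p : Γ × (ℕ → Bool)) : Rel c p p := ⟨0, fun _ _ => rfl, rfl⟩

theorem Rel.symm (h : Rel c p q) : Rel c q p := by
  obtain ⟨n, h1, h2⟩ := h
  exact ⟨n, fun i hi => (h1 i hi).symm, h2.symm⟩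

theorem Rel.trans (h : Rel c p q) (h' : Rel c q r) : Rel c p r := by
  obtain ⟨n, h1, h2⟩ := h
  obtain ⟨m, h3, h4⟩ := h'
  refine ⟨max n m, fun i hi => (h1 i (by omega)).trans (h3 i (by omega)), ?_⟩
  rw [mul_word_eq_of_le (le_max_left n m) h1 h2, mul_word_eq_of_le (le_max_right n m) h3 h4]

theorem Rel.mul_left (h : Rel c p q) (γ : Γ) : Rel c (γ * p.1, p.2) (γ * q.1, q.2) := by
  obtain ⟨n, h1, h2⟩ := h
  exact ⟨n, h1, by simp only [mul_assoc, h2]⟩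

/-- Sequences with the same tail and the same word are equal. -/
class UniqueWords (c : ℕ → Γ) : Prop where
  eq_of_word_eq : ∀ (y z : ℕ → Bool) (n : ℕ), (∀ i, n ≤ i → y i = z i) →
    word c y n = word c z n → y = z

theorem Rel.eq_of_fst_eq [UniqueWords c] (h : Rel c p q) (h1 : p.1 = q.1) : p = q := by
  obtain ⟨n, h2, h3⟩ := h
  rw [h1] at h3
  exact Prod.ext h1 (UniqueWords.eq_of_word_eq (c := c) _ _ n h2 (mul_left_cancel h3))

/-- Right translation on `Γ` and a finite flip on `{0,1}^ℕ`. -/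
def shift (i : Γ × Finset ℕ) (p : Γ × (ℕ → Bool)) : Γ × (ℕ → Bool) := (p.1 * i.1, flip i.2 p.2)

theorem shift_shift_inv (i : Γ × Finset ℕ) (p : Γ × (ℕ → Bool)) :
    shift (i.1⁻¹, i.2) (shift i p) = p := by
  simp [shift, flip_flip]

theorem shift_inv_shift (i : Γ × Finset ℕ) (p : Γ × (ℕ → Bool)) :
    shift i (shift (i.1⁻¹, i.2) p) = p := by
  simp [shift, flip_flip]

theorem shift_left_injective (p : Γ × (ℕ → Bool)) :
    Function.Injective fun i => shift i p := by
  rintro ⟨g, s⟩ ⟨h, t⟩ hst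
  obtain ⟨h1, h2⟩ := Prod.ext_iff.1 hst
  exact Prod.ext (mul_left_cancel h1) (flip_left_injective p.2 h2)

/-- Each class lies in the orbit of a point under a countable family of measure-preserving maps.
This turns quantifiers over a class into countable unions and intersections. -/
theorem Rel.exists_shift (h : Rel c p q) : ∃ i, q = shift i p := by
  obtain ⟨n, h1, -⟩ := h
  refine ⟨(p.1⁻¹ * q.1, (Finset.range n).filter fun i => p.2 i ≠ q.2 i), ?_⟩
  refine Prod.ext (by simp [shift]) (funext fun i => ?_)
  by_cases hi : i < n
  · cases hp : p.2 i <;> cases hq : q.2 i <;> simp [shift, flip, hi, hp, hq]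
  · simp [shift, flip, hi, h1 i (by omega)]

variable [Countable Γ]

/-- An injective numbering of the countable type `Γ`. -/
def code (Γ : Type) [Countable Γ] : Γ → ℕ := (exists_injective_nat Γ).choose

omit [Group Γ] in
theorem code_injective : Function.Injective (code Γ) := (exists_injective_nat Γ).choose_spec

/-- `p` has the smallest first coordinate of its class. -/
def IsRep (c : ℕ → Γ) (p : Γ × (ℕ → Bool)) : Prop := ∀ q, Rel c p q → code Γ p.1 ≤ code Γ q.1

theorem exists_rep (c : ℕ → Γ) (p : Γ × (ℕ → Bool)) : ∃ q, Rel c p q ∧ IsRep c q := by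
  obtain ⟨q, hq, hmin⟩ := WellFounded.has_min (measure fun q : Γ × (ℕ → Bool) => code Γ q.1).wf
    {q | Rel c p q} ⟨p, Rel.refl p⟩
  exact ⟨q, hq, fun r hr => not_lt.1 (hmin r (Rel.trans hq hr))⟩

/-- The representative of the class of `p`. -/
def rep (c : ℕ → Γ) (p : Γ × (ℕ → Bool)) : Γ × (ℕ → Bool) := (exists_rep c p).choose

theorem rel_rep (c : ℕ → Γ) (p : Γ × (ℕ → Bool)) : Rel c p (rep c p) :=
  (exists_rep c p).choose_spec.1

theorem isRep_rep (c : ℕ → Γ) (p : Γ × (ℕ → Bool)) : IsRep c (rep c p) :=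
  (exists_rep c p).choose_spec.2

theorem IsRep.eq [UniqueWords c] (hp : IsRep c p) (hq : IsRep c q) (h : Rel c p q) : p = q :=
  h.eq_of_fst_eq (code_injective (le_antisymm (hp q h) (hq p h.symm)))

theorem rep_eq [UniqueWords c] (h : Rel c p q) (hq : IsRep c q) : rep c p = q :=
  (isRep_rep c p).eq hq ((rel_rep c p).symm.trans h)

/-- The set of representatives of the classes of `Rel c`. -/
abbrev RepSpace (c : ℕ → Γ) : Type := {p : Γ × (ℕ → Bool) // IsRep c p}

/-- The relation only alters the first coordinate by right factors, so left multiplication passes to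
classes. -/
instance repAction [UniqueWords c] : MulAction Γ (RepSpace c) where
  smul γ x := ⟨rep c (γ * x.1.1, x.1.2), isRep_rep c _⟩
  one_smul x := Subtype.ext (rep_eq (by rw [one_mul]; exact Rel.refl _) x.2)
  mul_smul γ δ x := Subtype.ext (rep_eq (by
    have h := (rel_rep c (δ * x.1.1, x.1.2)).mul_left γ
    simp only [← mul_assoc] at h
    exact h.trans (rel_rep c _)) (isRep_rep c _))

theorem rel_smul [UniqueWords c] (γ : Γ) (x : RepSpace c) :
    Rel c (γ * x.1.1, x.1.2) (γ • x).1 := rel_rep c _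

/-- Both sides of the relation carry the same sequence, hence the same word, which cancels. -/
theorem eq_one_of_smul_eq [UniqueWords c] {γ : Γ} {x : RepSpace c} (h : γ • x = x) : γ = 1 := by
  obtain ⟨n, -, h2⟩ := h ▸ rel_smul γ x
  rw [mul_assoc] at h2
  exact mul_eq_right.1 h2

/-- The points of the space whose class meets `E`. -/
def saturate (c : ℕ → Γ) (E : Set (Γ × (ℕ → Bool))) : Set (RepSpace c) :=
  {x | ∃ p ∈ E, Rel c p x.1}

theorem val_image_saturate [UniqueWords c] (E : Set (Γ × (ℕ → Bool))) :
    Subtype.val '' saturate c E = rep c '' E := by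
  ext q
  constructor
  · rintro ⟨x, ⟨p, hp, hpx⟩, rfl⟩
    exact ⟨p, hp, rep_eq hpx x.2⟩
  · rintro ⟨p, hp, rfl⟩
    exact ⟨⟨rep c p, isRep_rep c p⟩, ⟨p, hp, rel_rep c p⟩, rfl⟩

theorem mem_smul_saturate [UniqueWords c] {γ : Γ} {E : Set (Γ × (ℕ → Bool))} {x : RepSpace c} :
    x ∈ γ • saturate c E ↔ ∃ p ∈ E, Rel c (γ * p.1, p.2) x.1 := by
  rw [Set.mem_smul_set_iff_inv_smul_mem]
  constructor
  · rintro ⟨p, hp, h⟩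
    refine ⟨p, hp, ?_⟩
    have h' := (h.trans (rel_smul γ⁻¹ x).symm).mul_left γ
    simpa using h'
  · rintro ⟨p, hp, h⟩
    refine ⟨p, hp, ?_⟩
    have h' := h.mul_left γ⁻¹
    simp only [inv_mul_cancel_left] at h'
    exact h'.trans (rel_smul γ⁻¹ x)

/-! ### Measurability and the invariant measure -/

section Measurable

variable [MeasurableSpace Γ] [DiscreteMeasurableSpace Γ]

omit [Countable Γ] in
theorem measurable_shift (i : Γ × Finset ℕ) : Measurable (shift i) :=
  ((Measurable.of_discrete (f := fun g : Γ => g * i.1)).comp measurable_fst).prodMk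
    ((measurable_flip i.2).comp measurable_snd)

theorem measurable_word (c : ℕ → Γ) (n : ℕ) : Measurable fun y => word c y n := by
  induction n with
  | zero => exact measurable_const
  | succ n ih =>
    have h : Measurable fun y : ℕ → Bool => (word c y n, y n) := ih.prodMk (measurable_pi_apply n)
    exact (Measurable.of_discrete
      (f := fun a : Γ × Bool => a.1 * (if a.2 then c n else 1))).comp h

theorem measurable_mul_word (c : ℕ → Γ) (n : ℕ) :
    Measurable fun p : Γ × (ℕ → Bool) => p.1 * word c p.2 n :=
  (Measurable.of_discrete (f := fun a : Γ × Γ => a.1 * a.2)).comp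
    (measurable_fst.prodMk ((measurable_word c n).comp measurable_snd))

theorem measurableSet_rel_shift (c : ℕ → Γ) (i : Γ × Finset ℕ) :
    MeasurableSet {p | Rel c p (shift i p)} := by
  have : {p | Rel c p (shift i p)} = ⋃ n, ((⋂ j, ⋂ (_ : n ≤ j), {p | p.2 j = (shift i p).2 j}) ∩
      {p | p.1 * word c p.2 n = (shift i p).1 * word c (shift i p).2 n}) := by
    ext p; simp [Rel]
  rw [this]
  refine MeasurableSet.iUnion fun n => (MeasurableSet.iInter fun j => MeasurableSet.iInter
    fun _ => ?_).inter ?_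
  · have h : Measurable fun p : Γ × (ℕ → Bool) => p.2 j :=
      (measurable_pi_apply j).comp measurable_snd
    exact measurableSet_eq_fun h (h.comp (measurable_shift i))
  · have h := measurable_mul_word c n
    have h' : Measurable fun p => (p.1 * word c p.2 n, (shift i p).1 * word c (shift i p).2 n) :=
      h.prodMk (h.comp (measurable_shift i))
    exact h' (MeasurableSet.of_discrete (s := {a : Γ × Γ | a.1 = a.2}))

theorem measurableSet_isRep (c : ℕ → Γ) : MeasurableSet {p | IsRep c p} := by
  have : {p | IsRep c p} = ⋂ i, ({p | Rel c p (shift i p)}ᶜ ∪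
      {p : Γ × (ℕ → Bool) | code Γ p.1 ≤ code Γ (p.1 * i.1)}) := by
    ext p
    simp only [mem_ofPred_eq, mem_iInter, mem_union, mem_compl_iff]
    constructor
    · intro h i
      by_cases hi : Rel c p (shift i p)
      · exact Or.inr (h _ hi)
      · exact Or.inl hi
    · rintro h q hq
      obtain ⟨i, rfl⟩ := hq.exists_shift
      exact (h i).resolve_left (not_not_intro hq)
  rw [this]
  refine MeasurableSet.iInter fun i => (measurableSet_rel_shift c i).compl.union ?_
  exact measurable_fst (MeasurableSet.of_discrete (s := {g : Γ | code Γ g ≤ code Γ (g * i.1)}))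

instance : StandardBorelSpace (RepSpace c) := (measurableSet_isRep c).standardBorel

theorem measurableSet_rep_eq_shift [UniqueWords c] (i : Γ × Finset ℕ) :
    MeasurableSet {p | rep c p = shift i p} := by
  have : {p | rep c p = shift i p} = {p | Rel c p (shift i p)} ∩ shift i ⁻¹' {p | IsRep c p} := by
    ext p
    constructor
    · intro h
      rw [mem_ofPred_eq] at h
      exact ⟨show Rel c p (shift i p) from h ▸ rel_rep c p,
        show IsRep c (shift i p) from h ▸ isRep_rep c p⟩
    · rintro ⟨h1, h2⟩
      exact rep_eq h1 h2
  rw [this]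
  exact (measurableSet_rel_shift c i).inter (measurable_shift i (measurableSet_isRep c))

theorem measurable_rep [UniqueWords c] : Measurable (rep c) := by
  intro E hE
  have : rep c ⁻¹' E = ⋃ i, ({p | rep c p = shift i p} ∩ shift i ⁻¹' E) := by
    ext p
    simp only [mem_preimage, mem_iUnion, mem_inter_iff, mem_ofPred_eq]
    constructor
    · intro h
      obtain ⟨i, hi⟩ := (rel_rep c p).exists_shift
      exact ⟨i, hi, hi ▸ h⟩
    · rintro ⟨i, hi, h⟩
      rwa [hi]
  rw [this]
  exact MeasurableSet.iUnion fun i =>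
    (measurableSet_rep_eq_shift i).inter (measurable_shift i hE)

instance [UniqueWords c] : MeasurableConstSMul Γ (RepSpace c) where
  measurable_const_smul γ := by
    refine Measurable.subtype_mk (measurable_rep.comp ?_)
    exact ((Measurable.of_discrete (f := fun g : Γ => γ * g)).comp
      (measurable_fst.comp measurable_subtype_coe)).prodMk
      (measurable_snd.comp measurable_subtype_coe)

theorem measurableSet_saturate {E : Set (Γ × (ℕ → Bool))} (hE : MeasurableSet E) :
    MeasurableSet (saturate c E) := by
  have : saturate c E = Subtype.val ⁻¹' ⋃ i, ({p | Rel c p (shift i p)} ∩ shift i ⁻¹' E) := by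
    ext x
    rw [mem_preimage, mem_iUnion]
    constructor
    · rintro ⟨p, hp, h⟩
      obtain ⟨i, rfl⟩ := h.symm.exists_shift
      exact ⟨i, h.symm, hp⟩
    · rintro ⟨i, h, hi⟩
      exact ⟨_, hi, h.symm⟩
  rw [this]
  exact measurable_subtype_coe (MeasurableSet.iUnion fun i =>
    (measurableSet_rel_shift c i).inter (measurable_shift i hE))

variable (Γ) in
/-- Counting measure times coin tossing. -/
def fullMeasure : Measure (Γ × (ℕ → Bool)) := Measure.count.prod coinMeasure

instance : SigmaFinite (fullMeasure Γ) := by unfold fullMeasure; infer_instance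

theorem measurePreserving_shift (i : Γ × Finset ℕ) :
    MeasurePreserving (shift i) (fullMeasure Γ) (fullMeasure Γ) :=
  (measurePreserving_mul_right Measure.count i.1).prod (measurePreserving_flip i.2)

theorem fullMeasure_shift_image (i : Γ × Finset ℕ) {E : Set (Γ × (ℕ → Bool))}
    (hE : MeasurableSet E) : fullMeasure Γ (shift i '' E) = fullMeasure Γ E := by
  rw [Set.image_eq_preimage_of_inverse (g := shift (i.1⁻¹, i.2)) (shift_shift_inv i)
    (shift_inv_shift i)]
  exact (measurePreserving_shift _).measure_preimage hE.nullMeasurableSet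

/-- Cut `E` according to which shift `rep` agrees with; on each piece `rep` is measure preserving.
Only an inequality holds because distinct pieces may have overlapping images. -/
theorem fullMeasure_rep_image_le [UniqueWords c] {E : Set (Γ × (ℕ → Bool))}
    (hE : MeasurableSet E) : fullMeasure Γ (rep c '' E) ≤ fullMeasure Γ E := by
  set D : Γ × Finset ℕ → Set (Γ × (ℕ → Bool)) := fun i => E ∩ {p | rep c p = shift i p} with hD
  have hDm : ∀ i, MeasurableSet (D i) := fun i => hE.inter (measurableSet_rep_eq_shift i)
  have hdis : Pairwise (Function.onFun Disjoint D) := by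
    intro i j hij
    refine Set.disjoint_left.2 ?_
    rintro p ⟨-, h1⟩ ⟨-, h2⟩
    rw [mem_ofPred_eq] at h1 h2
    exact hij (shift_left_injective p (h1.symm.trans h2))
  calc fullMeasure Γ (rep c '' E) ≤ fullMeasure Γ (⋃ i, shift i '' D i) := by
        refine measure_mono ?_
        rintro _ ⟨p, hp, rfl⟩
        obtain ⟨i, hi⟩ := (rel_rep c p).exists_shift
        exact mem_iUnion.2 ⟨i, p, ⟨hp, hi⟩, hi.symm⟩
    _ ≤ ∑' i, fullMeasure Γ (shift i '' D i) := measure_iUnion_le _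
    _ = ∑' i, fullMeasure Γ (D i) := by simp only [fullMeasure_shift_image _ (hDm _)]
    _ = fullMeasure Γ (⋃ i, D i) := (measure_iUnion hdis hDm).symm
    _ ≤ fullMeasure Γ E := measure_mono (iUnion_subset fun i => inter_subset_left)

theorem fullMeasure_eq_zero_of_rep_image {E : Set (Γ × (ℕ → Bool))}
    (h : fullMeasure Γ (rep c '' E) = 0) : fullMeasure Γ E = 0 := by
  refine measure_mono_null (t := ⋃ i, shift i ⁻¹' (rep c '' E)) ?_ (measure_iUnion_null fun i =>
    (measurePreserving_shift i).quasiMeasurePreserving.preimage_null h)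
  intro p hp
  obtain ⟨i, hi⟩ := (rel_rep c p).exists_shift
  exact mem_iUnion.2 ⟨i, p, hp, hi⟩

variable (c) in
/-- The invariant measure on the space of representatives. -/
def repMeasure : Measure (RepSpace c) := (fullMeasure Γ).comap Subtype.val

theorem repMeasure_apply (s : Set (RepSpace c)) :
    repMeasure c s = fullMeasure Γ (Subtype.val '' s) :=
  comap_subtype_coe_apply (measurableSet_isRep c) _ _

instance : SigmaFinite (repMeasure c) :=
  SigmaFinite.of_map _ measurable_subtype_coe.aemeasurable (by
    have h : (repMeasure c).map Subtype.val = _ :=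
      (MeasurableEmbedding.subtype_coe (measurableSet_isRep c)).map_comap (fullMeasure Γ)
    rw [h]
    infer_instance)

theorem repMeasure_saturate_le [UniqueWords c] {E : Set (Γ × (ℕ → Bool))}
    (hE : MeasurableSet E) : repMeasure c (saturate c E) ≤ fullMeasure Γ E := by
  rw [repMeasure_apply, val_image_saturate]
  exact fullMeasure_rep_image_le hE

theorem repMeasure_saturate_pos [UniqueWords c] {E : Set (Γ × (ℕ → Bool))}
    (hE : 0 < fullMeasure Γ E) : 0 < repMeasure c (saturate c E) := by
  rw [repMeasure_apply, val_image_saturate]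
  exact pos_iff_ne_zero.2 fun h => hE.ne' (fullMeasure_eq_zero_of_rep_image h)

omit [Group Γ] in
theorem fullMeasure_slice (g : Γ) (K : Set (ℕ → Bool)) :
    fullMeasure Γ ({g} ×ˢ K) = coinMeasure K := by
  rw [fullMeasure, Measure.prod_prod, Measure.count_singleton, one_mul]

theorem repMeasure_singleton (x : RepSpace c) : repMeasure c {x} = 0 := by
  rw [repMeasure_apply, image_singleton]
  have : ({x.1} : Set (Γ × (ℕ → Bool))) = {x.1.1} ×ˢ {x.1.2} := by simp
  rw [this, fullMeasure_slice, coinMeasure_singleton]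

theorem repMeasure_smul_le [UniqueWords c] (γ : Γ) {s : Set (RepSpace c)}
    (hs : MeasurableSet s) : repMeasure c (γ • s) ≤ repMeasure c s := by
  have h1 : Subtype.val '' (γ • s) = rep c '' ((fun p => (γ * p.1, p.2)) '' (Subtype.val '' s)) := by
    rw [← Set.image_smul, Set.image_image, Set.image_image, Set.image_image]
    rfl
  have hv : MeasurableSet (Subtype.val '' s) := (measurableSet_isRep c).subtype_image hs
  have h2 : ((fun p : Γ × (ℕ → Bool) => (γ * p.1, p.2)) '' (Subtype.val '' s))
      = (fun p => (γ⁻¹ * p.1, p.2)) ⁻¹' (Subtype.val '' s) := by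
    rw [Set.image_eq_preimage_of_inverse] <;> intro p <;> simp
  have hp : MeasurePreserving (fun p : Γ × (ℕ → Bool) => (γ⁻¹ * p.1, p.2)) (fullMeasure Γ)
      (fullMeasure Γ) :=
    (measurePreserving_mul_left Measure.count γ⁻¹).prod (MeasurePreserving.id coinMeasure)
  rw [repMeasure_apply, repMeasure_apply, h1, h2,
    ← hp.measure_preimage hv.nullMeasurableSet]
  exact fullMeasure_rep_image_le (hp.measurable hv)

theorem repMeasure_smul [UniqueWords c] (γ : Γ) {s : Set (RepSpace c)}
    (hs : MeasurableSet s) : repMeasure c (γ • s) = repMeasure c s := by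
  refine le_antisymm (repMeasure_smul_le γ hs) ?_
  -- The reverse inequality is the first one applied to the inverse element.
  have h := repMeasure_smul_le γ⁻¹ (hs.const_smul γ)
  rwa [inv_smul_smul] at h

instance [UniqueWords c] : SMulInvariantMeasure Γ (RepSpace c) (repMeasure c) where
  measure_preimage_smul γ s hs := by
    rw [Set.preimage_smul]
    exact repMeasure_smul _ hs

end Measurable

end Space

/-! ### Approximation by finitely many cylinders -/

theorem exists_cylinder_approx {K : Set (ℕ → Bool)} (hK : MeasurableSet K) {ε : ENNReal}
    (hε : 0 < ε) : ∃ (K' : Set (ℕ → Bool)) (N : ℕ), MeasurableSet K' ∧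
      (∀ y z : ℕ → Bool, (∀ i < N, y i = z i) → (y ∈ K' ↔ z ∈ K')) ∧
      coinMeasure (symmDiff K K') < ε := by
  have hd : coinMeasure.MeasureDense (measurableCylinders fun _ : ℕ => Bool) :=
    Measure.MeasureDense.of_generateFrom_isSetAlgebra_finite _ isSetAlgebra_measurableCylinders
      generateFrom_measurableCylinders.symm
  obtain ⟨δ, hδ, hδε⟩ := ENNReal.lt_iff_exists_real_btwn.1 hε
  have hδ0 : 0 < δ := by simpa using hδε.1
  obtain ⟨K', hK', h⟩ := hd.approx K hK (measure_ne_top _ _) δ hδ0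
  obtain ⟨s, S, hS, rfl⟩ := (mem_measurableCylinders _).1 hK'
  refine ⟨_, s.sup id + 1, hd.measurable _ hK', fun y z hyz => ?_, h.trans hδε.2⟩
  rw [mem_cylinder, mem_cylinder]
  have : s.restrict y = s.restrict z := by
    funext i
    exact hyz i (Nat.lt_succ_of_le (Finset.le_sup (f := id) i.2))
  rw [this]

section

variable {Γ : Type} [Group Γ] [Countable Γ] [MeasurableSpace Γ] [DiscreteMeasurableSpace Γ]
  {c : ℕ → Γ}

theorem exists_finite_level_approx {A : Set (Γ × (ℕ → Bool))} (hA : MeasurableSet A)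
    (hA' : fullMeasure Γ A ≠ ⊤) {ε : ENNReal} (hε : 0 < ε) :
    ∃ (G : Finset Γ) (K : Γ → Set (ℕ → Bool)) (N : ℕ),
      (∀ g, ∀ y z : ℕ → Bool, (∀ i < N, y i = z i) → (y ∈ K g ↔ z ∈ K g)) ∧
      MeasurableSet {p : Γ × (ℕ → Bool) | p.1 ∈ G ∧ p.2 ∈ K p.1} ∧
      fullMeasure Γ (symmDiff A {p | p.1 ∈ G ∧ p.2 ∈ K p.1}) ≤ ε := by
  classical
  set a : Γ → Set (ℕ → Bool) := fun g => {y | (g, y) ∈ A} with ha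
  have ham : ∀ g, MeasurableSet (a g) := fun g => measurable_prodMk_left hA
  set P : Γ → Set (Γ × (ℕ → Bool)) := fun g => {g} ×ˢ a g with hP
  have hPm : ∀ g, MeasurableSet (P g) := fun g => (measurableSet_singleton g).prod (ham g)
  have hdis : Pairwise (Function.onFun Disjoint P) := by
    intro g h hgh
    refine Set.disjoint_left.2 ?_
    rintro p ⟨h1, -⟩ ⟨h2, -⟩
    exact hgh (h1.symm.trans h2)
  have hsum : ∑' g, fullMeasure Γ (P g) ≠ ⊤ := by
    rw [← measure_iUnion hdis hPm]
    refine ne_top_of_le_ne_top hA' (measure_mono (iUnion_subset fun g => ?_))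
    rintro ⟨_, y⟩ ⟨rfl, hy⟩
    exact hy
  have hε2 : 0 < ε / 2 := ENNReal.half_pos hε.ne'
  -- Finitely many slices carry all but `ε / 2` of the measure of `A`.
  obtain ⟨G, hG⟩ := (((ENNReal.tendsto_nhds_zero.1
    (ENNReal.tendsto_tsum_compl_atTop_zero hsum)) (ε / 2) hε2)).exists
  -- The `+ 1` keeps the divisor nonzero when `G` is empty.
  have hδ : 0 < ε / 2 / (G.card + 1) :=
    ENNReal.div_pos hε2.ne' (by exact_mod_cast ENNReal.natCast_ne_top (G.card + 1))
  choose K N hKm hKN hKa using fun g => exists_cylinder_approx (ham g) hδ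
  refine ⟨G, fun g => if g ∈ G then K g else ∅, G.sup N, fun g y z hyz => ?_, ?_, ?_⟩
  · by_cases hg : g ∈ G
    · simp only [hg, if_true]
      exact hKN g y z fun i hi => hyz i (hi.trans_le (Finset.le_sup hg))
    · simp [hg]
  · have : {p : Γ × (ℕ → Bool) | p.1 ∈ G ∧ p.2 ∈ (if p.1 ∈ G then K p.1 else ∅)}
        = ⋃ g ∈ G, {g} ×ˢ K g := by
      ext ⟨g, y⟩
      simp +contextual
    rw [this]
    exact Finset.measurableSet_biUnion _ fun g _ => (measurableSet_singleton g).prod (hKm g)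
  · calc _ ≤ fullMeasure Γ ((⋃ g : {x // x ∉ G}, P g) ∪ ⋃ g ∈ G, {g} ×ˢ symmDiff (a g) (K g)) := by
          refine measure_mono ?_
          rintro ⟨g, y⟩ h
          by_cases hg : g ∈ G
          · refine Or.inr (mem_iUnion₂.2 ⟨g, hg, rfl, ?_⟩)
            simpa [Set.mem_symmDiff, hg, ha] using h
          · refine Or.inl (mem_iUnion.2 ⟨⟨g, hg⟩, rfl, ?_⟩)
            simpa [Set.mem_symmDiff, hg, ha] using h
      _ ≤ fullMeasure Γ (⋃ g : {x // x ∉ G}, P g)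
          + fullMeasure Γ (⋃ g ∈ G, {g} ×ˢ symmDiff (a g) (K g)) := measure_union_le _ _
      _ ≤ ε / 2 + ε / 2 := by
          refine add_le_add ((measure_iUnion_le _).trans hG) ?_
          calc _ ≤ ∑ g ∈ G, fullMeasure Γ ({g} ×ˢ symmDiff (a g) (K g)) :=
                measure_biUnion_finset_le _ _
            _ ≤ ∑ g ∈ G, ε / 2 / (G.card + 1) := Finset.sum_le_sum fun g _ => by
                rw [fullMeasure_slice]; exact (hKa g).le
            _ = G.card * (ε / 2 / (G.card + 1)) := by simp
            _ ≤ (G.card + 1) * (ε / 2 / (G.card + 1)) := by gcongr; simp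
            _ ≤ ε / 2 := ENNReal.mul_div_le
      _ = ε := ENNReal.add_halves ε

/-! ### Rokhlin towers and rank one -/

/-- The sequences whose first `n` terms vanish. -/
def zeros (n : ℕ) : Set (ℕ → Bool) := {y | ∀ i < n, y i = false}

theorem measurableSet_zeros (n : ℕ) : MeasurableSet (zeros n) := by
  have : zeros n = ⋂ i, ⋂ (_ : i < n), {y : ℕ → Bool | y i = false} := by ext; simp [zeros]
  rw [this]
  exact MeasurableSet.iInter fun i => MeasurableSet.iInter fun _ =>
    measurableSet_eq_fun (measurable_pi_apply i) measurable_const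

omit [Countable Γ] [MeasurableSpace Γ] [DiscreteMeasurableSpace Γ] in
theorem word_eq_one_of_mem_zeros {y : ℕ → Bool} {n : ℕ} (hy : y ∈ zeros n) : word c y n = 1 := by
  have h : ∀ m ≤ n, word c y m = 1 := by
    intro m hm
    induction m with
    | zero => rfl
    | succ m ih => rw [word, ih (by omega), hy m (by omega)]; simp
  exact h n le_rfl

variable (c) in
/-- The base of the `n`-th tower. -/
def base (n : ℕ) : Set (RepSpace c) := saturate c ({1} ×ˢ zeros n)

theorem measurableSet_base (n : ℕ) : MeasurableSet (base c n) :=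
  measurableSet_saturate ((measurableSet_singleton 1).prod (measurableSet_zeros n))

variable [UniqueWords c]

theorem repMeasure_base_lt_top (n : ℕ) : repMeasure c (base c n) < ⊤ := by
  refine (repMeasure_saturate_le
    ((measurableSet_singleton 1).prod (measurableSet_zeros n))).trans_lt ?_
  rw [fullMeasure_slice]
  exact measure_lt_top _ _

theorem repMeasure_base_pos (n : ℕ) : 0 < repMeasure c (base c n) := by
  refine repMeasure_saturate_pos ?_
  rw [fullMeasure_slice, zeros, coinMeasure_cylinder (fun _ => false) n]
  exact ENNReal.pow_pos (by simp) n

omit [MeasurableSpace Γ] [DiscreteMeasurableSpace Γ] in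
theorem mem_smul_base {γ : Γ} {n : ℕ} {x : RepSpace c} :
    x ∈ γ • base c n ↔ ∃ y ∈ zeros n, Rel c (γ, y) x.1 := by
  rw [base, mem_smul_saturate]
  constructor
  · rintro ⟨⟨_, y⟩, ⟨rfl, hy⟩, h⟩
    exact ⟨y, hy, by simpa using h⟩
  · rintro ⟨y, hy, h⟩
    exact ⟨(1, y), ⟨rfl, hy⟩, by simpa using h⟩

omit [MeasurableSpace Γ] [DiscreteMeasurableSpace Γ] in
theorem exists_word_eq_of_mem_smul_base {γ δ : Γ} {n : ℕ} {x : RepSpace c} (h : x ∈ γ • base c n)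
    (h' : x ∈ δ • base c n) : ∃ y ∈ zeros n, ∃ z ∈ zeros n, ∃ m, γ * word c y m = δ * word c z m := by
  obtain ⟨y, hy, h1⟩ := mem_smul_base.1 h
  obtain ⟨z, hz, h2⟩ := mem_smul_base.1 h'
  obtain ⟨m, -, h3⟩ := h1.trans h2.symm
  exact ⟨y, hy, z, hz, m, h3⟩

omit [MeasurableSpace Γ] [DiscreteMeasurableSpace Γ] in
-- Zeroing the first `n` digits of `y` and absorbing them into `g` turns a cylinder of length `n`
-- over `g` into the tower level at `g * word c y n`.
theorem saturate_eq_iUnion_smul_base {F G : Finset Γ} {K : Γ → Set (ℕ → Bool)} {n : ℕ}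
    (hK : ∀ g, ∀ y z : ℕ → Bool, (∀ i < n, y i = z i) → (y ∈ K g ↔ z ∈ K g))
    (hF : ∀ g ∈ G, ∀ y, g * word c y n ∈ F) :
    ∃ S ⊆ F, saturate c {p | p.1 ∈ G ∧ p.2 ∈ K p.1} = ⋃ f ∈ S, f • base c n := by
  classical
  refine ⟨F.filter fun f => ∃ g ∈ G, ∃ y ∈ K g, f = g * word c y n, Finset.filter_subset _ _, ?_⟩
  ext x
  simp only [mem_iUnion, Finset.mem_filter, exists_prop]
  constructor
  · rintro ⟨⟨g, y⟩, ⟨hg, hy⟩, h⟩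
    refine ⟨g * word c y n, ⟨hF g hg y, g, hg, y, hy, rfl⟩, mem_smul_base.2 ?_⟩
    have hz : (fun i => if i < n then false else y i) ∈ zeros n := fun i hi => by simp [hi]
    refine ⟨_, hz, Rel.trans ⟨n, fun i hi => ?_, ?_⟩ h⟩
    · simp [Nat.not_lt.2 hi]
    · simp only [word_eq_one_of_mem_zeros hz, mul_one]
  · rintro ⟨f, ⟨-, g, hg, y, hy, rfl⟩, h⟩
    obtain ⟨z, hz, h⟩ := mem_smul_base.1 h
    refine ⟨(g, fun i => if i < n then y i else z i), ⟨hg, (hK g _ _ fun i hi => ?_).2 hy⟩,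
      Rel.trans ⟨n, fun i hi => ?_, ?_⟩ h⟩
    · simp [hi]
    · simp [Nat.not_lt.2 hi]
    · simp only [word_eq_one_of_mem_zeros hz, mul_one]
      rw [word_congr c (z := y)]
      intro i hi
      simp [hi]

omit [MeasurableSpace Γ] [DiscreteMeasurableSpace Γ] in
theorem saturate_val_image (A : Set (RepSpace c)) : saturate c (Subtype.val '' A) = A := by
  ext x
  constructor
  · rintro ⟨_, ⟨y, hy, rfl⟩, h⟩
    rwa [← Subtype.ext (y.2.eq x.2 h)]
  · intro hx
    exact ⟨x.1, ⟨x, hx, rfl⟩, Rel.refl _⟩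

omit [MeasurableSpace Γ] [DiscreteMeasurableSpace Γ] [UniqueWords c] in
theorem symmDiff_saturate_subset (E E' : Set (Γ × (ℕ → Bool))) :
    symmDiff (saturate c E) (saturate c E') ⊆ saturate c (symmDiff E E') := by
  rintro x (⟨⟨p, hp, h⟩, hx⟩ | ⟨⟨p, hp, h⟩, hx⟩)
  · exact ⟨p, Or.inl ⟨hp, fun h' => hx ⟨p, h', h⟩⟩, h⟩
  · exact ⟨p, Or.inr ⟨hp, fun h' => hx ⟨p, h', h⟩⟩, h⟩

theorem eventually_exists_levels_approx {F : ℕ → Finset Γ}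
    (hF : ∀ g, ∀ᶠ n in Filter.atTop, ∀ y, g * word c y n ∈ F n)
    {A : Set (RepSpace c)} (hA : MeasurableSet A) (hA' : repMeasure c A < ⊤) {ε : ENNReal}
    (hε : 0 < ε) : ∀ᶠ n in Filter.atTop, ∃ S ⊆ F n,
      repMeasure c (symmDiff A (⋃ f ∈ S, f • base c n)) ≤ ε := by
  have hAm : MeasurableSet (Subtype.val '' A) := (measurableSet_isRep c).subtype_image hA
  rw [repMeasure_apply] at hA'
  obtain ⟨G, K, N, hK, hm, hle⟩ := exists_finite_level_approx hAm hA'.ne hε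
  filter_upwards [Filter.eventually_ge_atTop N,
    (Filter.eventually_all_finset G).2 fun g _ => hF g] with n hn hG
  obtain ⟨S, hS, h⟩ := saturate_eq_iUnion_smul_base (c := c) (K := K)
    (fun g y z hyz => hK g y z fun i hi => hyz i (hi.trans_le hn)) hG
  refine ⟨S, hS, ?_⟩
  rw [← h]
  nth_rewrite 1 [← saturate_val_image A]
  exact (measure_mono (symmDiff_saturate_subset _ _)).trans
    ((repMeasure_saturate_le (hAm.symmDiff hm)).trans hle)

/-- `hF` says that the shapes eventually absorb every slice, so that levels approximate all sets;
`hdis` gives disjointness of the levels. -/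
theorem isRankOne_repMeasure {F : ℕ → Finset Γ} (hFol : IsFolnerSeq F)
    (hF : ∀ g, ∀ᶠ n in Filter.atTop, ∀ y, g * word c y n ∈ F n)
    (hdis : ∀ n, ∀ f ∈ F n, ∀ f' ∈ F n, ∀ y ∈ zeros n, ∀ z ∈ zeros n, ∀ m,
      f * word c y m = f' * word c z m → f = f') :
    IsRankOne Γ (repMeasure c) := by
  refine ⟨F, hFol, base c, fun n => ⟨measurableSet_base n, repMeasure_base_lt_top n⟩, ?_, ?_⟩
  · intro n f hf f' hf' hne
    refine Set.disjoint_left.2 fun x hx hx' => hne ?_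
    obtain ⟨y, hy, z, hz, m, h⟩ := exists_word_eq_of_mem_smul_base hx hx'
    exact hdis n f hf f' hf' y hy z hz m h
  · intro A hA hA'
    -- Taking the best union of levels for each `n` gives one sequence that serves every `ε`.
    choose S hS hmin using fun n => Finset.exists_min_image (F n).powerset
      (fun S => repMeasure c (symmDiff A (⋃ f ∈ S, f • base c n))) ⟨∅, by simp⟩
    refine ⟨S, fun n => Finset.mem_powerset.1 (hS n), ENNReal.tendsto_nhds_zero.2 fun ε hε => ?_⟩
    filter_upwards [eventually_exists_levels_approx hF hA hA' hε] with n ⟨T, hT, hle⟩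
    exact (hmin n T (Finset.mem_powerset.2 hT)).trans hle

/-- The sets `z k • base c 0` are infinitely many disjoint translates of one set of positive
measure. -/
theorem repMeasure_univ_eq_top {z : ℕ → Γ}
    (hz : ∀ j k, ∀ y w : ℕ → Bool, ∀ m, z j * word c y m = z k * word c w m → j = k) :
    repMeasure c univ = ⊤ := by
  have hdis : Pairwise (Function.onFun Disjoint fun k => z k • base c 0) := by
    intro j k hjk
    refine Set.disjoint_left.2 fun x hx hx' => hjk ?_
    obtain ⟨y, -, w, -, m, h⟩ := exists_word_eq_of_mem_smul_base hx hx'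
    exact hz j k y w m h
  refine top_le_iff.1 ?_
  calc ⊤ = ∑' _ : ℕ, repMeasure c (base c 0) :=
        (ENNReal.tsum_const_eq_top_of_ne_zero (repMeasure_base_pos 0).ne').symm
    _ = ∑' k, repMeasure c (z k • base c 0) := by
        simp only [repMeasure_smul _ (measurableSet_base 0)]
    _ = repMeasure c (⋃ k, z k • base c 0) :=
        (measure_iUnion hdis fun k => (measurableSet_base 0).const_smul (z k)).symm
    _ ≤ repMeasure c univ := measure_mono (subset_univ _)

end

/-! ### Coordinates on the lattice and growth of the words -/

/-- The integral Heisenberg matrix with entries `a`, `b` above the diagonal and `c` in the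
corner. -/
def heis (a b c : ℤ) : heisenbergLattice :=
  ⟨⟨⟨!![1, (a : ℝ), c; 0, 1, b; 0, 0, 1], by simp [Matrix.det_fin_three]⟩, by
    refine ⟨fun i => ?_, fun i j hij => ?_⟩
    · fin_cases i <;> simp
    · fin_cases i <;> fin_cases j <;> first
        | exact absurd hij (by decide)
        | simp⟩, by
    intro i j
    simp only [heisenbergMatrix]
    fin_cases i <;> fin_cases j
    exacts [⟨1, by simp⟩, ⟨a, by simp⟩, ⟨c, by simp⟩, ⟨0, by simp⟩, ⟨1, by simp⟩, ⟨b, by simp⟩,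
      ⟨0, by simp⟩, ⟨0, by simp⟩, ⟨1, by simp⟩]⟩

theorem heisenbergMatrix_heis (a b c : ℤ) :
    heisenbergMatrix (heis a b c : heisenbergGroup) = !![1, (a : ℝ), c; 0, 1, b; 0, 0, 1] := rfl

theorem heisenbergMatrix_injective : Function.Injective heisenbergMatrix :=
  fun _ _ h => Subtype.ext (Subtype.ext h)

theorem heisenbergMatrix_mul (g h : heisenbergGroup) :
    heisenbergMatrix (g * h) = heisenbergMatrix g * heisenbergMatrix h := rfl

theorem heis_mul (a b c a' b' c' : ℤ) :
    heis a b c * heis a' b' c' = heis (a + a') (b + b') (c + c' + a * b') := by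
  refine Subtype.ext (heisenbergMatrix_injective ?_)
  rw [Subgroup.coe_mul, heisenbergMatrix_mul]
  simp only [heisenbergMatrix_heis]
  ext i j
  fin_cases i <;> fin_cases j <;> simp [Matrix.mul_apply, Fin.sum_univ_three] <;> ring

theorem heis_inj {a b c a' b' c' : ℤ} :
    heis a b c = heis a' b' c' ↔ a = a' ∧ b = b' ∧ c = c' := by
  constructor
  · intro h
    have h' : (!![1, (a : ℝ), c; 0, 1, b; 0, 0, 1] : Matrix (Fin 3) (Fin 3) ℝ)
        = !![1, (a' : ℝ), c'; 0, 1, b'; 0, 0, 1] := by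
      rw [← heisenbergMatrix_heis, ← heisenbergMatrix_heis, h]
    exact ⟨by simpa using congrFun (congrFun h' 0) 1, by simpa using congrFun (congrFun h' 1) 2,
      by simpa using congrFun (congrFun h' 0) 2⟩
  · rintro ⟨rfl, rfl, rfl⟩
    rfl

theorem exists_heis_eq (γ : heisenbergLattice) : ∃ a b c, γ = heis a b c := by
  obtain ⟨a, ha⟩ := γ.2 0 1
  obtain ⟨b, hb⟩ := γ.2 1 2
  obtain ⟨c, hc⟩ := γ.2 0 2
  refine ⟨a, b, c, Subtype.ext (heisenbergMatrix_injective ?_)⟩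
  rw [heisenbergMatrix_heis]
  obtain ⟨h1, h2⟩ := γ.1.2
  have e1 : heisenbergMatrix γ.1 1 0 = 0 := h2 1 0 (by decide)
  have e2 : heisenbergMatrix γ.1 2 0 = 0 := h2 2 0 (by decide)
  have e3 : heisenbergMatrix γ.1 2 1 = 0 := h2 2 1 (by decide)
  have e : ∀ i, heisenbergMatrix γ.1 i i = 1 := h1
  ext i j
  fin_cases i <;> fin_cases j <;> simp [ha, hb, hc, e, e1, e2, e3]

theorem heis_zero : heis 0 0 0 = 1 := by
  have h := heis_mul 0 0 0 0 0 0
  simp only [add_zero, mul_zero] at h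
  exact mul_eq_right.1 h

instance : Countable heisenbergLattice :=
  Function.Surjective.countable (f := fun p : ℤ × ℤ × ℤ => heis p.1 p.2.1 p.2.2) fun γ => by
    obtain ⟨a, b, c, rfl⟩ := exists_heis_eq γ
    exact ⟨(a, b, c), rfl⟩

/-- The cutting-and-stacking parameters: the element `(8 ^ i, 2 ^ i, 0)` of `H₃(ℤ)`. -/
def spacer (i : ℕ) : heisenbergLattice := heis (8 ^ i) (2 ^ i) 0

/-- The sum `∑_{i < n} 8 ^ i`. -/
def sumEight (n : ℕ) : ℤ := ∑ i ∈ Finset.range n, 8 ^ i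

theorem sumEight_succ (n : ℕ) : sumEight (n + 1) = sumEight n + 8 ^ n :=
  Finset.sum_range_succ _ _

theorem seven_mul_sumEight (n : ℕ) : 7 * sumEight n + 1 = 8 ^ n := by
  induction n with
  | zero => simp [sumEight]
  | succ n ih => rw [sumEight_succ, pow_succ]; linarith

theorem le_sumEight (n : ℕ) : (n : ℤ) ≤ sumEight n := by
  induction n with
  | zero => simp [sumEight]
  | succ n ih =>
    rw [sumEight_succ]
    have : (0 : ℤ) < 8 ^ n := by positivity
    push_cast
    linarith

theorem sumEight_mono : Monotone sumEight := monotone_nat_of_le_succ fun n => by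
  rw [sumEight_succ]
  have : (0 : ℤ) < 8 ^ n := by positivity
  linarith

theorem two_pow_le_eight_pow (n : ℕ) : (2 : ℤ) ^ n ≤ 8 ^ n :=
  pow_le_pow_left₀ (by norm_num) (by norm_num) n

/-- The sum of the `w i` over the `i < n` with `y i = 1`. -/
def digitSum (w : ℕ → ℤ) (y : ℕ → Bool) (n : ℕ) : ℤ :=
  ∑ i ∈ Finset.range n, (if y i then 1 else 0) * w i

theorem digitSum_succ (w : ℕ → ℤ) (y : ℕ → Bool) (n : ℕ) :
    digitSum w y (n + 1) = digitSum w y n + (if y n then 1 else 0) * w n :=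
  Finset.sum_range_succ _ _

theorem word_spacer (y : ℕ → Bool) (n : ℕ) :
    ∃ e, word spacer y n = heis (digitSum (8 ^ ·) y n) (digitSum (2 ^ ·) y n) e ∧
      0 ≤ e ∧ e ≤ sumEight n ^ 2 ∧
      0 ≤ digitSum (8 ^ ·) y n ∧ digitSum (8 ^ ·) y n ≤ sumEight n ∧
      0 ≤ digitSum (2 ^ ·) y n ∧ digitSum (2 ^ ·) y n ≤ sumEight n := by
  induction n with
  | zero => exact ⟨0, by simp [digitSum, word, heis_zero, sumEight]⟩
  | succ n ih =>
    obtain ⟨e, h, h1, h2, h3, h4, h5, h6⟩ := ih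
    have h8 : (0 : ℤ) < 2 ^ n := by positivity
    have h9 := two_pow_le_eight_pow n
    rw [word, h, sumEight_succ, digitSum_succ, digitSum_succ]
    generalize digitSum (8 ^ ·) y n = u at *
    generalize digitSum (2 ^ ·) y n = v at *
    generalize sumEight n = s at *
    cases y n
    · simp only [Bool.false_eq_true, if_false, mul_one, zero_mul, add_zero]
      exact ⟨e, rfl, h1, by nlinarith, h3, by linarith, h5, by linarith⟩
    · simp only [if_true, one_mul]
      refine ⟨e + 0 + u * 2 ^ n, by rw [spacer, heis_mul], by positivity, ?_, by linarith,
        by linarith, by linarith, by linarith⟩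
      -- The new corner term is at most `s * 8 ^ n`, which the cross term of `(s + 8 ^ n) ^ 2`
      -- absorbs.
      nlinarith [mul_le_mul h4 h9 h8.le (h3.trans h4)]

/-- `k` is the largest index below `m` with `d k ≠ 0`. Its term beats the sum of the lower ones in
base 2 as in base 8: narrowly in base 2, by a fixed proportion of `8 ^ k` in base 8. -/
theorem digit_dichotomy {d : ℕ → ℤ} (hd : ∀ i, |d i| ≤ 1) {n : ℕ} (hz : ∀ i < n, d i = 0)
    (m : ℕ) : (∀ i < m, d i = 0) ∨ ∃ k, n ≤ k ∧
      1 ≤ |∑ i ∈ Finset.range m, d i * 2 ^ i| ∧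
      |∑ i ∈ Finset.range m, d i * 2 ^ i| < 2 ^ (k + 1) ∧
      8 ^ k - sumEight k ≤ |∑ i ∈ Finset.range m, d i * 8 ^ i| := by
  have h8 : ∀ m, |∑ i ∈ Finset.range m, d i * 8 ^ i| ≤ sumEight m := fun m => by
    refine (Finset.abs_sum_le_sum_abs _ _).trans (Finset.sum_le_sum fun i _ => ?_)
    rw [abs_mul, abs_of_pos (by positivity : (0 : ℤ) < 8 ^ i)]
    exact mul_le_of_le_one_left (by positivity) (hd i)
  have h2 : ∀ m, |∑ i ∈ Finset.range m, d i * 2 ^ i| < 2 ^ m := fun m => by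
    induction m with
    | zero => simp
    | succ m ih =>
      rw [Finset.sum_range_succ, pow_succ]
      have h1 := hd m
      have h3 : |d m * 2 ^ m| ≤ 2 ^ m := by
        rw [abs_mul, abs_of_pos (by positivity : (0 : ℤ) < 2 ^ m)]
        exact mul_le_of_le_one_left (by positivity) h1
      have := abs_add_le (∑ i ∈ Finset.range m, d i * 2 ^ i) (d m * 2 ^ m)
      linarith
  induction m with
  | zero => exact Or.inl (by simp)
  | succ m ih =>
    by_cases hm : d m = 0
    · rw [Finset.sum_range_succ, Finset.sum_range_succ, hm]
      simp only [zero_mul, add_zero]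
      refine ih.imp_left fun h i hi => ?_
      rcases Nat.lt_succ_iff_lt_or_eq.1 hi with hi | rfl
      · exact h i hi
      · exact hm
    · refine Or.inr ⟨m, not_lt.1 fun h => hm (hz m h), ?_, h2 _, ?_⟩
      · rw [Finset.sum_range_succ]
        have h1 := h2 m
        have hdm : 1 ≤ |d m| := Int.one_le_abs hm
        have h3 : 2 ^ m ≤ |d m * 2 ^ m| := by
          rw [abs_mul, abs_of_pos (by positivity : (0 : ℤ) < 2 ^ m)]
          exact le_mul_of_one_le_left (by positivity) hdm
        have h4 := abs_sub_abs_le_abs_sub (d m * 2 ^ m) (-∑ i ∈ Finset.range m, d i * 2 ^ i)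
        rw [abs_neg, sub_neg_eq_add, add_comm (d m * 2 ^ m)] at h4
        linarith
      · rw [Finset.sum_range_succ]
        have h1 := h8 m
        have hdm : 1 ≤ |d m| := Int.one_le_abs hm
        have h3 : 8 ^ m ≤ |d m * 8 ^ m| := by
          rw [abs_mul, abs_of_pos (by positivity : (0 : ℤ) < 8 ^ m)]
          exact le_mul_of_one_le_left (by positivity) hdm
        have h4 := abs_sub_abs_le_abs_sub (d m * 8 ^ m) (-∑ i ∈ Finset.range m, d i * 8 ^ i)
        rw [abs_neg, sub_neg_eq_add, add_comm (d m * 8 ^ m)] at h4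
        linarith

/-- Modulo the centre the equation is additive, and digit differences of the two sequences give the
entries of `(a - a', b - b')`. If all differences vanish, the words cancel and the corner entries
agree too. -/
theorem word_eq_dichotomy {a b e a' b' e' : ℤ} {y z : ℕ → Bool} {n m : ℕ} (hy : y ∈ zeros n)
    (hz : z ∈ zeros n)
    (h : heis a b e * word spacer y m = heis a' b' e' * word spacer z m) :
    ((∀ i < m, y i = z i) ∧ heis a b e = heis a' b' e') ∨
    ∃ k, n ≤ k ∧ 1 ≤ |b - b'| ∧ |b - b'| < 2 ^ (k + 1) ∧ 8 ^ k - sumEight k ≤ |a - a'| := by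
  set d : ℕ → ℤ := fun i => (if z i then 1 else 0) - (if y i then 1 else 0) with hd
  have hd1 : ∀ i, |d i| ≤ 1 := fun i => by
    simp only [hd]; cases y i <;> cases z i <;> simp
  have hd0 : ∀ i < n, d i = 0 := fun i hi => by simp [hd, hy i hi, hz i hi]
  obtain ⟨u, hu, -⟩ := word_spacer y m
  obtain ⟨v, hv, -⟩ := word_spacer z m
  have hab := h
  rw [hu, hv, heis_mul, heis_mul, heis_inj] at hab
  have hs : ∀ w : ℕ → ℤ, ∑ i ∈ Finset.range m, d i * w i = digitSum w z m - digitSum w y m := by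
    intro w
    simp only [hd, sub_mul, Finset.sum_sub_distrib, digitSum]
  rcases digit_dichotomy hd1 hd0 m with h0 | ⟨k, hk, h1, h2, h3⟩
  · left
    have hyz : ∀ i < m, y i = z i := fun i hi => by
      have := h0 i hi
      simp only [hd] at this
      cases hyi : y i <;> cases hzi : z i <;> simp [hyi, hzi] at this ⊢
    rw [word_congr spacer hyz] at h
    exact ⟨hyz, mul_right_cancel h⟩
  · right
    rw [hs (8 ^ ·)] at h3
    rw [hs (2 ^ ·)] at h1 h2
    rw [show b - b' = digitSum (2 ^ ·) z m - digitSum (2 ^ ·) y m by linarith [hab.2.1],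
      show a - a' = digitSum (8 ^ ·) z m - digitSum (8 ^ ·) y m by linarith [hab.1]]
    exact ⟨k, hk, h1, h2, h3⟩

theorem mem_zeros_zero (y : ℕ → Bool) : y ∈ zeros 0 := fun i hi => absurd hi (by omega)

instance : UniqueWords spacer where
  eq_of_word_eq y z m ht h := by
    have h' : heis 0 0 0 * word spacer y m = heis 0 0 0 * word spacer z m := by rw [h]
    rcases word_eq_dichotomy (mem_zeros_zero y) (mem_zeros_zero z) h' with h0 | ⟨k, -, h1, -⟩
    · funext i
      rcases lt_or_ge i m with hi | hi
      · exact h0.1 i hi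
      · exact ht i hi
    · simp at h1

theorem center_eq_of_word_eq (j k : ℕ) (y w : ℕ → Bool) (m : ℕ)
    (h : heis 0 0 j * word spacer y m = heis 0 0 k * word spacer w m) : j = k := by
  rcases word_eq_dichotomy (mem_zeros_zero y) (mem_zeros_zero w) h with h0 | ⟨k, -, h1, -⟩
  · exact_mod_cast (heis_inj.1 h0.2).2.2
  · simp at h1

/-! ### Tower shapes and the Følner property -/

/-- The box of all `(a, b, c)` in `H₃(ℤ)` with `|a|, |b| ≤ r` and `|c| ≤ q`. -/
def box (r q : ℤ) : Finset heisenbergLattice :=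
  (Finset.Icc (-r) r ×ˢ Finset.Icc (-r) r ×ˢ Finset.Icc (-q) q).map
    ⟨fun p => heis p.1 p.2.1 p.2.2, fun p p' h => by
      obtain ⟨h1, h2, h3⟩ := heis_inj.1 h
      exact Prod.ext h1 (Prod.ext h2 h3)⟩

theorem heis_mem_box {a b c r q : ℤ} : heis a b c ∈ box r q ↔ |a| ≤ r ∧ |b| ≤ r ∧ |c| ≤ q := by
  simp only [box, Finset.mem_map, abs_le]
  constructor
  · rintro ⟨⟨a', b', c'⟩, h, h'⟩
    obtain ⟨rfl, rfl, rfl⟩ := heis_inj.1 h'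
    simpa only [Finset.mem_product, Finset.mem_Icc] using h
  · intro h
    exact ⟨(a, b, c), by simpa only [Finset.mem_product, Finset.mem_Icc] using h, rfl⟩

theorem card_box {r q : ℤ} (hr : 0 ≤ r) (hq : 0 ≤ q) :
    ((box r q).card : ℝ) = (2 * r + 1) ^ 2 * (2 * q + 1) := by
  have h : ((box r q).card : ℤ) = (2 * r + 1) ^ 2 * (2 * q + 1) := by
    rw [box, Finset.card_map, Finset.card_product, Finset.card_product, Int.card_Icc, Int.card_Icc]
    push_cast
    rw [Int.toNat_of_nonneg (by linarith), Int.toNat_of_nonneg (by linarith)]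
    ring
  exact_mod_cast h

/-- The side of the `n`-th tower. -/
def side (n : ℕ) : ℤ := n + sumEight n

/-- The shape of the `n`-th tower. -/
def shape (n : ℕ) : Finset heisenbergLattice := box (side n) (side n ^ 2)

theorem le_side (n : ℕ) : (n : ℤ) ≤ side n := by
  have := le_sumEight n
  unfold side
  omega

theorem side_nonneg (n : ℕ) : 0 ≤ side n := le_trans (by positivity) (le_side n)

/-- In `side n = n + sumEight n`, the second summand bounds the entries of words above the diagonal
and the first absorbs `g`. In the corner, `n + s ^ 2 + n * s ≤ (n + s) ^ 2`. -/
theorem eventually_mul_word_mem_shape (g : heisenbergLattice) :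
    ∀ᶠ n in Filter.atTop, ∀ y, g * word spacer y n ∈ shape n := by
  obtain ⟨a, b, c, rfl⟩ := exists_heis_eq g
  filter_upwards [Filter.eventually_ge_atTop (|a| + |b| + |c|).toNat] with n hn y
  have hn' : |a| + |b| + |c| ≤ n := Int.toNat_le.1 hn
  obtain ⟨e, h, h1, h2, h3, h4, h5, h6⟩ := word_spacer y n
  have ha := abs_nonneg a
  have hb := abs_nonneg b
  have hc := abs_nonneg c
  rw [h, heis_mul, shape, heis_mem_box, side]
  generalize digitSum (8 ^ ·) y n = u at *
  generalize digitSum (2 ^ ·) y n = v at *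
  generalize sumEight n = s at *
  refine ⟨?_, ?_, ?_⟩
  · have := abs_add_le a u
    rw [abs_of_nonneg h3] at this
    linarith
  · have := abs_add_le b v
    rw [abs_of_nonneg h5] at this
    linarith
  · have h7 := abs_add_three c e (a * v)
    rw [abs_of_nonneg h1, abs_mul, abs_of_nonneg h5] at h7
    have h8 : |a| * v ≤ n * s := mul_le_mul (by linarith) h6 h5 (by linarith)
    nlinarith

/-- Elements of the box differ in the first entry by at most `2 * side n ≤ 4 * sumEight k`, whereas
distinct words force `8 ^ k - sumEight k = 6 * sumEight k + 1`. -/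
theorem shape_disjoint (n : ℕ) (f : heisenbergLattice) (hf : f ∈ shape n) (f' : heisenbergLattice)
    (hf' : f' ∈ shape n) (y : ℕ → Bool) (hy : y ∈ zeros n) (z : ℕ → Bool) (hz : z ∈ zeros n)
    (m : ℕ) (h : f * word spacer y m = f' * word spacer z m) : f = f' := by
  obtain ⟨a, b, c, rfl⟩ := exists_heis_eq f
  obtain ⟨a', b', c', rfl⟩ := exists_heis_eq f'
  rcases word_eq_dichotomy hy hz h with h0 | ⟨k, hk, -, -, h3⟩
  · exact h0.2
  · exfalso
    have h4 := (heis_mem_box.1 hf).1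
    have h5 := (heis_mem_box.1 hf').1
    have h6 := abs_sub a a'
    have h7 := sumEight_mono hk
    have h8 := seven_mul_sumEight k
    have h9 := le_sumEight k
    unfold side at h4 h5
    have : (n : ℤ) ≤ k := by exact_mod_cast hk
    linarith

/-- Both `F` and `γ • F` contain `γ • I`, and each exceeds it by `F.card - I.card` elements. -/
theorem ncard_symmDiff_smul_le {Γ : Type*} [Group Γ] {F I : Finset Γ} {γ : Γ} (hI : I ⊆ F)
    (h : ∀ g ∈ I, γ * g ∈ F) :
    ((symmDiff (γ • (F : Set Γ)) (F : Set Γ)).ncard : ℝ) ≤ 2 * ((F.card : ℝ) - I.card) := by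
  have hc : (γ • (I : Set Γ)).ncard = I.card := by
    rw [← Set.image_smul, Set.ncard_image_of_injective _ (MulAction.injective γ),
      Set.ncard_coe_finset]
  have hF : (γ • (F : Set Γ)).ncard = F.card := by
    rw [← Set.image_smul, Set.ncard_image_of_injective _ (MulAction.injective γ),
      Set.ncard_coe_finset]
  have hfin : (γ • (I : Set Γ)).Finite := (Finset.finite_toSet I).smul_set
  have hfin' : (γ • (F : Set Γ)).Finite := (Finset.finite_toSet F).smul_set
  have h1 : γ • (I : Set Γ) ⊆ γ • (F : Set Γ) := Set.smul_set_mono (by exact_mod_cast hI)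
  have h2 : γ • (I : Set Γ) ⊆ (F : Set Γ) := by
    rintro _ ⟨g, hg, rfl⟩
    exact h g hg
  have hsub : symmDiff (γ • (F : Set Γ)) (F : Set Γ)
      ⊆ (γ • (F : Set Γ) \ γ • (I : Set Γ)) ∪ ((F : Set Γ) \ γ • (I : Set Γ)) := by
    rintro x (⟨hx, hx'⟩ | ⟨hx, hx'⟩)
    · exact Or.inl ⟨hx, fun hi => hx' (h2 hi)⟩
    · exact Or.inr ⟨hx, fun hi => hx' (h1 hi)⟩
  have h3 := Set.ncard_sdiff_add_ncard_of_subset h1 hfin'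
  have h4 := Set.ncard_sdiff_add_ncard_of_subset h2 F.finite_toSet
  rw [hc, hF] at h3
  rw [hc, Set.ncard_coe_finset] at h4
  have h5 := (Set.ncard_le_ncard hsub ((hfin'.subset sdiff_subset).union
    (F.finite_toSet.subset sdiff_subset))).trans (Set.ncard_union_le _ _)
  have h6 : (symmDiff (γ • (F : Set Γ)) (F : Set Γ)).ncard + 2 * I.card ≤ 2 * F.card := by omega
  have h7 : ((symmDiff (γ • (F : Set Γ)) (F : Set Γ)).ncard : ℝ) + 2 * I.card ≤ 2 * F.card := by
    exact_mod_cast h6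
  linarith

theorem tendsto_side : Filter.Tendsto (fun n => (side n : ℝ)) Filter.atTop Filter.atTop :=
  Filter.tendsto_atTop_mono (fun n => by exact_mod_cast le_side n) tendsto_natCast_atTop_atTop

theorem isFolnerSeq_shape : IsFolnerSeq shape := by
  refine ⟨fun n => ⟨heis 0 0 0, ?_⟩, fun γ => ?_⟩
  · have := side_nonneg n
    simp only [shape, heis_mem_box, abs_zero]
    exact ⟨this, this, by positivity⟩
  obtain ⟨a, b, c, rfl⟩ := exists_heis_eq γ
  set k : ℤ := |a| + |b| + |c| with hk
  have ha := abs_nonneg a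
  have hb := abs_nonneg b
  have hc := abs_nonneg c
  have hk0 : 0 ≤ k := by positivity
  have hu : Filter.Tendsto (fun n => 2 * (k : ℝ) / (2 * side n + 1)) Filter.atTop (nhds 0) := by
    refine tendsto_const_nhds.div_atTop ?_
    exact Filter.tendsto_atTop_add_const_right _ _ (tendsto_side.const_mul_atTop (by norm_num))
  have hw : Filter.Tendsto (fun n => 2 * (k : ℝ) * (side n + 1) / (2 * (side n : ℝ) ^ 2 + 1))
      Filter.atTop (nhds 0) := by
    have h2 : Filter.Tendsto (fun n => 2 * (k : ℝ) / side n) Filter.atTop (nhds 0) :=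
      tendsto_const_nhds.div_atTop tendsto_side
    have hk' : (0 : ℝ) ≤ k := by exact_mod_cast hk0
    refine squeeze_zero' (Filter.Eventually.of_forall fun n => ?_) ?_ h2
    · have : (0 : ℝ) ≤ side n := by exact_mod_cast side_nonneg n
      positivity
    · filter_upwards [tendsto_side.eventually_ge_atTop 1] with n hn
      rw [div_le_div_iff₀ (by positivity) (by linarith)]
      rw [mul_assoc]
      refine mul_le_mul_of_nonneg_left ?_ (by positivity)
      nlinarith [sq_nonneg ((side n : ℝ) - 1)]
  have hlim : Filter.Tendsto (fun n => 2 * (1 - (1 - 2 * (k : ℝ) / (2 * side n + 1)) ^ 2 *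
      (1 - 2 * (k : ℝ) * (side n + 1) / (2 * (side n : ℝ) ^ 2 + 1)))) Filter.atTop (nhds 0) := by
    have := (tendsto_const_nhds (x := (2 : ℝ))).mul ((tendsto_const_nhds (x := (1 : ℝ))).sub
      ((((tendsto_const_nhds (x := (1 : ℝ))).sub hu).pow 2).mul
        ((tendsto_const_nhds (x := (1 : ℝ))).sub hw)))
    simpa using this
  refine squeeze_zero' (Filter.Eventually.of_forall fun n => by positivity) ?_ hlim
  filter_upwards [Filter.eventually_ge_atTop (2 * k + 1).toNat] with n hn
  have hr : 2 * k + 1 ≤ side n := (Int.toNat_le.1 hn).trans (le_side n)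
  set r := side n with hrdef
  -- The corner margin `k * (r + 1)` pays `k` for `|c|` and `k * r` for the shear `|a * b'|`; it is
  -- small against `r ^ 2`.
  have hq0 : 0 ≤ r ^ 2 - k * (r + 1) := by nlinarith
  have hsub : box (r - k) (r ^ 2 - k * (r + 1)) ⊆ shape n := by
    intro g hg
    obtain ⟨a', b', c', rfl⟩ := exists_heis_eq g
    obtain ⟨h1, h2, h3⟩ := heis_mem_box.1 hg
    refine heis_mem_box.2 ⟨by linarith, by linarith, ?_⟩
    rw [← hrdef]
    nlinarith
  have hmul : ∀ g ∈ box (r - k) (r ^ 2 - k * (r + 1)), heis a b c * g ∈ shape n := by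
    intro g hg
    obtain ⟨a', b', c', rfl⟩ := exists_heis_eq g
    obtain ⟨h1, h2, h3⟩ := heis_mem_box.1 hg
    rw [heis_mul]
    refine heis_mem_box.2 ⟨?_, ?_, ?_⟩ <;> rw [← hrdef]
    · linarith [abs_add_le a a']
    · linarith [abs_add_le b b']
    · have h4 := abs_add_three c c' (a * b')
      rw [abs_mul] at h4
      have h5 : |a| * |b'| ≤ k * r :=
        mul_le_mul (by linarith) (by linarith) (abs_nonneg _) hk0
      nlinarith
  have hF : ((shape n).card : ℝ) = (2 * (r : ℝ) + 1) ^ 2 * (2 * (r : ℝ) ^ 2 + 1) := by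
    rw [shape, ← hrdef, card_box (by linarith) (by positivity)]
    push_cast
    ring
  have hI := card_box (r := r - k) (by linarith) hq0
  have hr0 : (0 : ℝ) ≤ r := by exact_mod_cast (by linarith : (0 : ℤ) ≤ r)
  refine (div_le_div_of_nonneg_right (ncard_symmDiff_smul_le hsub hmul) (by positivity)).trans
    (le_of_eq ?_)
  rw [hI, hF]
  push_cast
  have h1 : (2 * (r : ℝ) + 1) ≠ 0 := by positivity
  have h2 : (2 * (r : ℝ) ^ 2 + 1) ≠ 0 := by positivity
  field_simp
  ring

/-! ### Absence of recurrent directions -/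

theorem exp_apply_of_strictUpper {v : Matrix (Fin 3) (Fin 3) ℝ} (hv : ∀ i j, j ≤ i → v i j = 0) :
    NormedSpace.exp v 0 1 = v 0 1 ∧ NormedSpace.exp v 1 2 = v 1 2 := by
  -- The exponential stops at the square, which only touches the corner.
  have h3 : v ^ 3 = 0 := by
    ext i j
    fin_cases i <;> fin_cases j <;>
      simp [pow_succ, Matrix.mul_apply, Fin.sum_univ_three, hv 0 0, hv 1 0, hv 1 1, hv 2 0, hv 2 1,
        hv 2 2]
  have h : NormedSpace.exp v = ∑ n ∈ Finset.range 3, ((n.factorial : ℝ)⁻¹) • v ^ n := by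
    rw [NormedSpace.exp_eq_tsum ℝ]
    refine tsum_eq_sum fun n hn => ?_
    rw [pow_eq_zero_of_le (not_lt.1 fun h => hn (Finset.mem_range.2 h)) h3, smul_zero]
  rw [h]
  constructor <;>
    simp [Finset.sum_range_succ, pow_succ, Matrix.mul_apply, Fin.sum_univ_three, hv 0 0, hv 1 0,
      hv 1 1, hv 2 1, hv 2 2]

theorem heisenbergMatrix_mul_apply (g h : heisenbergGroup) :
    heisenbergMatrix (g * h) 0 1 = heisenbergMatrix g 0 1 + heisenbergMatrix h 0 1 ∧
    heisenbergMatrix (g * h) 1 2 = heisenbergMatrix g 1 2 + heisenbergMatrix h 1 2 := by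
  have hg1 : heisenbergMatrix g 0 0 = 1 := g.2.1 0
  have hg2 : heisenbergMatrix g 1 1 = 1 := g.2.1 1
  have hg3 : heisenbergMatrix g 1 0 = 0 := g.2.2 1 0 (by decide)
  have hh1 : heisenbergMatrix h 1 1 = 1 := h.2.1 1
  have hh2 : heisenbergMatrix h 2 2 = 1 := h.2.1 2
  have hh3 : heisenbergMatrix h 2 1 = 0 := h.2.2 2 1 (by decide)
  rw [heisenbergMatrix_mul]
  simp only [Matrix.mul_apply, Fin.sum_univ_three, hg1, hg2, hg3, hh1, hh2, hh3]
  constructor <;> ring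

/-- Right invariance moves the pair to `(g * h⁻¹, 1)`, where compatibility gives a neighbourhood;
the two entries are additive, so they become differences again. -/
theorem exists_dist_lt_imp_entries (m : MetricSpace heisenbergGroup)
    (hm : IsRightInvariantCompatible m) : ∃ ε > 0, ∀ g h : heisenbergGroup, m.dist g h < ε →
      |heisenbergMatrix g 0 1 - heisenbergMatrix h 0 1| < 1 ∧
      |heisenbergMatrix g 1 2 - heisenbergMatrix h 1 2| < 1 := by
  have hcont : ∀ i j, Continuous fun g : heisenbergGroup => heisenbergMatrix g i j := fun i j =>
    (Continuous.matrix_elem continuous_subtype_val i j).comp continuous_subtype_val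
  have hone : ∀ i j, i ≠ j → heisenbergMatrix 1 i j = 0 := fun i j hij => Matrix.one_apply_ne hij
  have hU : {g : heisenbergGroup | |heisenbergMatrix g 0 1| < 1 ∧ |heisenbergMatrix g 1 2| < 1}
      ∈ nhds (1 : heisenbergGroup) := by
    refine IsOpen.mem_nhds ((isOpen_lt (hcont 0 1).abs continuous_const).inter
      (isOpen_lt (hcont 1 2).abs continuous_const)) ?_
    simp [hone]
  obtain ⟨htop, hinv⟩ := hm
  rw [← htop] at hU
  obtain ⟨ε, hε, hball⟩ := (@Metric.mem_nhds_iff _ m.toPseudoMetricSpace _ _).1 hU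
  refine ⟨ε, hε, fun g h hgh => ?_⟩
  have hmem : g * h⁻¹ ∈ {g : heisenbergGroup | |heisenbergMatrix g 0 1| < 1 ∧
      |heisenbergMatrix g 1 2| < 1} := by
    refine hball ?_
    have := hinv g h h⁻¹
    rw [mul_inv_cancel] at this
    exact (show m.dist (g * h⁻¹) 1 < ε by rw [this]; exact hgh)
  have := heisenbergMatrix_mul_apply (g * h⁻¹) h
  rw [inv_mul_cancel_right] at this
  rw [this.1, this.2, add_sub_cancel_right, add_sub_cancel_right]
  exact hmem

variable [MeasurableSpace heisenbergLattice] [DiscreteMeasurableSpace heisenbergLattice]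

theorem recurrentDirections_eq_empty (m : MetricSpace heisenbergGroup)
    (hm : IsRightInvariantCompatible m) :
    recurrentDirections m (repMeasure spacer) = ∅ := by
  refine Set.eq_empty_iff_forall_notMem.2 fun θ hθ => ?_
  obtain ⟨ε, hε, hdist⟩ := exists_dist_lt_imp_entries m hm
  set v : Matrix (Fin 3) (Fin 3) ℝ := (θ.rep : Matrix (Fin 3) (Fin 3) ℝ) with hv
  set α := v 0 1
  set β := v 1 2
  -- A point of the line within 1 of `(a, b)`, with `|b| ≥ 1`, forces `|β| * |a| ≤ (2 * |α| + |β|) *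
  -- |b|`; this `n` contradicts it once `n * |b| ≤ |a|`.
  obtain ⟨n, hn⟩ : ∃ n : ℕ, β ≠ 0 → 2 * |α| + |β| < n * |β| := by
    by_cases hβ : β = 0
    · exact ⟨0, fun h => absurd hβ h⟩
    · obtain ⟨n, hn⟩ := exists_nat_gt ((2 * |α| + |β|) / |β|)
      exact ⟨n, fun _ => (div_lt_iff₀ (abs_pos.2 hβ)).1 hn⟩
  obtain ⟨γ, hγ, ⟨g, ⟨w, hw, hg⟩, hgd⟩, hpos⟩ :=
    hθ ε hε (base spacer n) (measurableSet_base n) (repMeasure_base_pos n)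
  obtain ⟨x, hx, hx'⟩ := nonempty_of_measure_ne_zero hpos.ne'
  rw [← one_smul heisenbergLattice (base spacer n)] at hx
  obtain ⟨y, hy, z, hz, l, h⟩ := exists_word_eq_of_mem_smul_base hx' hx
  obtain ⟨a, b, c, rfl⟩ := exists_heis_eq γ
  rw [← heis_zero] at h hγ
  rcases word_eq_dichotomy hy hz h with h0 | ⟨k, hk, h1, h2, h3⟩
  · exact hγ h0.2
  rw [sub_zero] at h1 h2 h3
  -- By Bernoulli `8 ^ k = 4 ^ k * 2 ^ k ≥ (1 + 3 * k) * 2 ^ k`, and six sevenths of this exceeds `k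
  -- * 2 ^ (k + 1)`.
  have hab : (n : ℤ) * |b| ≤ |a| := by
    have h4 : (1 : ℤ) + k * 3 ≤ (1 + 3) ^ k := one_add_mul_le_pow (by norm_num) k
    have h5 := seven_mul_sumEight k
    have h6 : (8 : ℤ) ^ k = (1 + 3) ^ k * 2 ^ k := by rw [← mul_pow]; norm_num
    have h7 : (0 : ℤ) < 2 ^ k := by positivity
    have h8 : (n : ℤ) * |b| ≤ k * 2 ^ (k + 1) :=
      mul_le_mul (by exact_mod_cast hk) h2.le (abs_nonneg b) (by positivity)
    rw [pow_succ] at h8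
    have h9 := mul_le_mul_of_nonneg_right h4 h7.le
    nlinarith
  have habR : (n : ℝ) * |(b : ℝ)| ≤ |(a : ℝ)| := by exact_mod_cast hab
  have h1R : (1 : ℝ) ≤ |(b : ℝ)| := by exact_mod_cast h1
  rw [Projectivization.submodule_eq, Submodule.mem_span_singleton] at hw
  obtain ⟨t, rfl⟩ := hw
  obtain ⟨e1, e2⟩ := exp_apply_of_strictUpper (t • θ.rep).2
  rw [← hg] at e1 e2
  obtain ⟨d1, d2⟩ := hdist _ _ hgd
  rw [e1] at d1
  rw [e2] at d2
  rw [heisenbergMatrix_heis] at d1 d2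
  have d1' : |(a : ℝ) - t * α| < 1 := by simpa using d1
  have d2' : |(b : ℝ) - t * β| < 1 := by simpa using d2
  by_cases hβ : β = 0
  -- Here `|b| < 1`, against `b` being a nonzero integer; this also covers the central line.
  · rw [hβ, mul_zero, sub_zero] at d2'
    linarith
  · have f1 : |(a : ℝ)| ≤ |t| * |α| + 1 := by
      have := abs_sub_abs_le_abs_sub (a : ℝ) (t * α)
      rw [abs_mul] at this
      linarith
    have f2 : |t| * |β| ≤ |(b : ℝ)| + 1 := by
      have := abs_sub_abs_le_abs_sub (t * β) (b : ℝ)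
      rw [abs_mul, abs_sub_comm] at this
      linarith
    have f3 := hn hβ
    have f4 := abs_nonneg α
    have f5 := abs_nonneg β
    have f6 : |β| * |(a : ℝ)| ≤ (2 * |α| + |β|) * |(b : ℝ)| := by
      calc |β| * |(a : ℝ)| ≤ |β| * (|t| * |α| + 1) := mul_le_mul_of_nonneg_left f1 f5
        _ = (|t| * |β|) * |α| + |β| := by ring
        _ ≤ (|(b : ℝ)| + 1) * |α| + |β| := by gcongr
        _ ≤ (2 * |α| + |β|) * |(b : ℝ)| := by nlinarith
    have f7 : (2 * |α| + |β|) * |(b : ℝ)| < n * |β| * |(b : ℝ)| :=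
      mul_lt_mul_of_pos_right f3 (by linarith)
    have f8 : |β| * (n * |(b : ℝ)|) ≤ |β| * |(a : ℝ)| := mul_le_mul_of_nonneg_left habR f5
    nlinarith

end CutStack

end

theorem theorem6p1 :
    ∃ (X : Type) (_ : MeasurableSpace X) (_ : StandardBorelSpace X)
      (_ : MulAction heisenbergLattice X) (_ : MeasurableConstSMul heisenbergLattice X)
      (μ : MeasureTheory.Measure X),
      MeasureTheory.SigmaFinite μ ∧
      (∀ x : X, μ {x} = 0) ∧
      μ Set.univ = ⊤ ∧
      MeasureTheory.SMulInvariantMeasure heisenbergLattice X μ ∧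
      (∀ (γ : heisenbergLattice) (x : X), γ • x = x → γ = 1) ∧
      IsRankOne heisenbergLattice μ ∧
      ∀ m : MetricSpace heisenbergGroup, IsRightInvariantCompatible m →
        recurrentDirections m μ = ∅ := by
  let _ : MeasurableSpace heisenbergLattice := ⊤
  have : DiscreteMeasurableSpace heisenbergLattice := ⟨fun _ => trivial⟩
  exact ⟨CutStack.RepSpace CutStack.spacer, inferInstance, inferInstance, inferInstance,
    inferInstance, CutStack.repMeasure CutStack.spacer, inferInstance,
    CutStack.repMeasure_singleton,
    CutStack.repMeasure_univ_eq_top (z := fun k => CutStack.heis 0 0 k)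
      CutStack.center_eq_of_word_eq,
    inferInstance, fun _ _ => CutStack.eq_one_of_smul_eq,
    CutStack.isRankOne_repMeasure CutStack.isFolnerSeq_shape
      CutStack.eventually_mul_word_mem_shape CutStack.shape_disjoint,
    CutStack.recurrentDirections_eq_empty⟩
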